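/- Let Stern's sequence $(a_n)_{n\ge 0}$ and its twisted version $(b_n)_{n\ge 0}$ be defined by $a_0=b_0=0$, $a_1=b_1=1$ and, for all $n\ge 1$, \[a_{2n}=a_n,\quad a_{2n+1}=a_n+a_{n+1},\qquad b_{2n}=-b_n,\quad b_{2n+1}=-(b_n+b_{n+1}),\] and for real $|z|<1$ put \[A(z)=\sum_{n\ge 0}a_{n+1}z^n,\qquad B(z)=\sum_{n\ge 0}b_{n+1}z^n.\] For real numbers $\alpha_1,\dots,\alpha_n$ let the simultaneous approximation exponent $\mu(\alpha_1,\dots,\alpha_n)\in\mathbb{R}\cup\{\pm\infty\}$ be the supremum of the real numbers $\mu$ such that \[\max_{1\le i\le n}\left|\alpha_i-\frac{p_i}{q}\right|<\frac{1}{q^{\mu}}\] is satisfied by infinitely many rational points $(p_1/q,\dots,p_n/q)$, where $p_1,\dots,p_n,q$ are integers and $q\ge 1$. Then, for all integers $b\ge 2$, \[\mu\left(A\left(\tfrac1b\right),B\left(\tfrac1b\right)\right)\le\frac85 .\] Moreover, if $a\neq 0$ and $b\ge 2$ are integers and $\lambda$ is the real number with $\log|a|=\lambda\log b$, and if $0\le\lambda<50/77$,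 then \[\mu\left(A\left(\tfrac ab\right),B\left(\tfrac ab\right)\right)\le\frac{80(1-\lambda)}{50-77\lambda}.\] -/

import Mathlib

/-- Stern's diatomic sequence: `a₀ = 0`, `a₁ = 1`, `a₂ₙ = aₙ`, `a₂ₙ₊₁ = aₙ + aₙ₊₁` for `n ≥ 1`. -/
def stern : ℕ → ℤ
  | 0 => 0
  | 1 => 1
  | n + 2 =>
    if n % 2 = 0 then stern (n / 2 + 1)
    else stern (n / 2 + 1) + stern (n / 2 + 2)
termination_by n => n
decreasing_by all_goals omega

/-- The twisted Stern sequence: `b₀ = 0`, `b₁ = 1`, `b₂ₙ = -bₙ`, `b₂ₙ₊₁ = -(bₙ + bₙ₊₁)` for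
`n ≥ 1`. -/
def twistedStern : ℕ → ℤ
  | 0 => 0
  | 1 => 1
  | n + 2 =>
    if n % 2 = 0 then -twistedStern (n / 2 + 1)
    else -(twistedStern (n / 2 + 1) + twistedStern (n / 2 + 2))
termination_by n => n
decreasing_by all_goals omega

theorem stern_even (n : ℕ) (hn : 1 ≤ n) : stern (2 * n) = stern n := by
  obtain ⟨m, rfl⟩ := Nat.exists_eq_add_of_le' hn
  rw [show 2 * (m + 1) = 2 * m + 2 by ring, stern, if_pos (by omega),
    show 2 * m / 2 + 1 = m + 1 by omega]

theorem stern_odd (n : ℕ) (hn : 1 ≤ n) : stern (2 * n + 1) = stern n + stern (n + 1) := by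
  obtain ⟨m, rfl⟩ := Nat.exists_eq_add_of_le' hn
  rw [show 2 * (m + 1) + 1 = (2 * m + 1) + 2 by ring, stern, if_neg (by omega),
    show (2 * m + 1) / 2 + 1 = m + 1 by omega, show (2 * m + 1) / 2 + 2 = m + 1 + 1 by omega]

theorem twistedStern_even (n : ℕ) (hn : 1 ≤ n) :
    twistedStern (2 * n) = -twistedStern n := by
  obtain ⟨m, rfl⟩ := Nat.exists_eq_add_of_le' hn
  rw [show 2 * (m + 1) = 2 * m + 2 by ring, twistedStern, if_pos (by omega),
    show 2 * m / 2 + 1 = m + 1 by omega]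

theorem twistedStern_odd (n : ℕ) (hn : 1 ≤ n) :
    twistedStern (2 * n + 1) = -(twistedStern n + twistedStern (n + 1)) := by
  obtain ⟨m, rfl⟩ := Nat.exists_eq_add_of_le' hn
  rw [show 2 * (m + 1) + 1 = (2 * m + 1) + 2 by ring, twistedStern, if_neg (by omega),
    show (2 * m + 1) / 2 + 1 = m + 1 by omega, show (2 * m + 1) / 2 + 2 = m + 1 + 1 by omega]

theorem abs_stern_le (n : ℕ) : |stern n| ≤ n := by
  induction n using Nat.strong_induction_on with
  | _ n ih =>
    match n, ih with
    | 0, _ => simp [stern]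
    | 1, _ => simp [stern]
    | m + 2, ih =>
      have h1 := ih (m / 2 + 1) (by omega)
      rw [stern]
      split_ifs with h
      · refine h1.trans ?_
        push_cast
        omega
      · have h2 := ih (m / 2 + 2) (by omega)
        refine (abs_add_le _ _).trans ((add_le_add h1 h2).trans ?_)
        push_cast
        omega

theorem abs_twistedStern_le (n : ℕ) : |twistedStern n| ≤ n := by
  induction n using Nat.strong_induction_on with
  | _ n ih =>
    match n, ih with
    | 0, _ => simp [twistedStern]
    | 1, _ => simp [twistedStern]
    | m + 2, ih =>
      have h1 := ih (m / 2 + 1) (by omega)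
      rw [twistedStern]
      split_ifs with h
      · rw [abs_neg]
        refine h1.trans ?_
        push_cast
        omega
      · have h2 := ih (m / 2 + 2) (by omega)
        rw [abs_neg]
        refine (abs_add_le _ _).trans ((add_le_add h1 h2).trans ?_)
        push_cast
        omega

theorem summable_of_abs_le (u : ℕ → ℤ) (hu : ∀ n : ℕ, |u n| ≤ n) (z : ℝ) (hz : |z| < 1) :
    Summable (fun n : ℕ => (u (n + 1) : ℝ) * z ^ n) := by
  have hz' : ‖|z|‖ < 1 := by simpa using hz
  have h1 : Summable (fun n : ℕ => ((n : ℝ) + 1) * |z| ^ n) := by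
    have := (summable_pow_mul_geometric_of_norm_lt_one 1 hz').add
      (summable_geometric_of_norm_lt_one hz')
    refine this.congr fun n => ?_
    ring
  refine Summable.of_norm_bounded h1 fun n => ?_
  rw [norm_mul, norm_pow, Real.norm_eq_abs, Real.norm_eq_abs]
  refine mul_le_mul_of_nonneg_right ?_ (by positivity)
  exact_mod_cast hu (n + 1)

/-- The generating function `A(z) = ∑ aₙ₊₁ zⁿ`, for real `z`. -/
noncomputable def sternA (z : ℝ) : ℝ := ∑' n : ℕ, (stern (n + 1) : ℝ) * z ^ n

/-- The generating function `B(z) = ∑ bₙ₊₁ zⁿ`, for real `z`. -/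
noncomputable def sternB (z : ℝ) : ℝ := ∑' n : ℕ, (twistedStern (n + 1) : ℝ) * z ^ n

/-- The series defining `A(z)` converges to it whenever `|z| < 1`. -/
theorem hasSum_sternA (z : ℝ) (hz : |z| < 1) :
    HasSum (fun n : ℕ => (stern (n + 1) : ℝ) * z ^ n) (sternA z) :=
  (summable_of_abs_le stern abs_stern_le z hz).hasSum

/-- The series defining `B(z)` converges to it whenever `|z| < 1`. -/
theorem hasSum_sternB (z : ℝ) (hz : |z| < 1) :
    HasSum (fun n : ℕ => (twistedStern (n + 1) : ℝ) * z ^ n) (sternB z) :=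
  (summable_of_abs_le twistedStern abs_twistedStern_le z hz).hasSum

/-- The rational points `r = (p₁/q, …, pₙ/q)`, with a common denominator `q ≥ 1`, that satisfy
`max_i |αᵢ - pᵢ/q| < 1 / q ^ μ`. -/
def simApproxSolutions {n : ℕ} (α : Fin n → ℝ) (μ : ℝ) : Set (Fin n → ℚ) :=
  {r | ∃ (q : ℕ) (p : Fin n → ℤ), 1 ≤ q ∧ (∀ i, r i = (p i : ℚ) / (q : ℚ)) ∧
    ∀ i, |α i - (p i : ℝ) / (q : ℝ)| < 1 / (q : ℝ) ^ μ}

/-- The simultaneous approximation exponent of `α₁, …, αₙ`: the supremum, in the extended real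
numbers, of the real `μ` such that `max_i |αᵢ - pᵢ/q| < 1 / q ^ μ` has infinitely many rational
solutions. -/
noncomputable def simApproxExponent {n : ℕ} (α : Fin n → ℝ) : EReal :=
  sSup {x : EReal | ∃ μ : ℝ, x = (μ : EReal) ∧ (simApproxSolutions α μ).Infinite}

/-! Both generating functions are Mahler functions of degree 2: A(z) = (1+z+z²)A(z²) and B(z) = 2 −
(1+z+z²)B(z²). Iterating k times gives A(z) = P_k(z)A(w) and B(z) = R_k(z) + (−1)^k P_k(z)B(w), with
w = z^(2^k) and integer polynomials P_k, R_k.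

A form C₀ + C₁A + C₂B vanishing to order exactly N at 0 can thus be evaluated at w and multiplied by
P_k(z), giving a small form in 1, A(z), B(z). For z = a/b with |z| = b^(−θ), θ = 1 − λ, the factor
b^(D·2^k) clears denominators: the coefficients have size at most about b^(D·2^k), and the value has
size b^(−e·2^k), e = Nθ − D, from both sides (`HasHermitePadeForm.eventually_hasIntegerForms`). The
value is nonzero because P_k(z) tends to A(z) ≠ 0.

The two-sided estimate makes a single form enough to rule out a good approximation (p₁/q, p₂/q): q
times the form at that point is an integer, so it is either 0, against the lower bound, or at least
1 in absolute value, against the upper bound (`not_approx_of_form`). This needs forms of closely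
spaced quality. A finite chain of pairs (D, N) from (18, 53) to its double (36, 106) suffices, since
doubling a pair amounts to raising k by one. The 16 forms needed are explicit and checked by
computation. -/

open Filter Topology Polynomial

/-! ### Generating functions of Stern-like sequences -/

/-- The recurrence shared by Stern's sequence (`ε = 1`) and its twist (`ε = -1`), together with
the linear growth bound. -/
structure IsSternLike (ε : ℤ) (u : ℕ → ℤ) : Prop where
  zero : u 0 = 0
  one : u 1 = 1
  even : ∀ n, 1 ≤ n → u (2 * n) = ε * u n
  odd : ∀ n, 1 ≤ n → u (2 * n + 1) = ε * (u n + u (n + 1))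
  abs_le : ∀ n : ℕ, |u n| ≤ n

theorem isSternLike_stern : IsSternLike 1 stern where
  zero := by simp [stern]
  one := by simp [stern]
  even n hn := by rw [stern_even n hn, one_mul]
  odd n hn := by rw [stern_odd n hn, one_mul]
  abs_le := abs_stern_le

theorem isSternLike_twistedStern : IsSternLike (-1) twistedStern where
  zero := by simp [twistedStern]
  one := by simp [twistedStern]
  even n hn := by rw [twistedStern_even n hn, neg_one_mul]
  odd n hn := by rw [twistedStern_odd n hn, neg_one_mul]
  abs_le := abs_twistedStern_le

/-- The generating function `∑ uₙ₊₁ zⁿ`. -/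
noncomputable def shiftedGenFun (u : ℕ → ℤ) (z : ℝ) : ℝ := ∑' n : ℕ, (u (n + 1) : ℝ) * z ^ n

/-- The Taylor polynomial of `shiftedGenFun u` of length `M`. -/
noncomputable def shiftedTrunc (u : ℕ → ℤ) (M : ℕ) : ℤ[X] :=
  ∑ n ∈ Finset.range M, monomial n (u (n + 1))

namespace IsSternLike

variable {ε : ℤ} {u : ℕ → ℤ}

theorem hasSum (hu : IsSternLike ε u) {z : ℝ} (hz : |z| < 1) :
    HasSum (fun n : ℕ => (u (n + 1) : ℝ) * z ^ n) (shiftedGenFun u z) :=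
  (summable_of_abs_le u hu.abs_le z hz).hasSum

theorem functional_equation (hu : IsSternLike ε u) {z : ℝ} (hz : |z| < 1) :
    shiftedGenFun u z = (1 - ε) + ε * (1 + z + z ^ 2) * shiftedGenFun u (z ^ 2) := by
  have hz2 : |z ^ 2| < 1 := by
    rw [abs_pow]
    exact pow_lt_one₀ (abs_nonneg z) hz two_ne_zero
  have hF := hu.hasSum hz2
  have hshift : HasSum (fun n : ℕ => (u n : ℝ) * (z ^ 2) ^ n)
      (z ^ 2 * shiftedGenFun u (z ^ 2)) := by
    rw [← hasSum_nat_add_iff' 1]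
    simp only [Finset.range_one, Finset.sum_singleton, hu.zero, Int.cast_zero, zero_mul, sub_zero]
    refine (hF.mul_left (z ^ 2)).congr_fun fun n => ?_
    ring
  have hodd : HasSum (fun n : ℕ => (u (2 * n + 1 + 1) : ℝ) * z ^ (2 * n + 1))
      (ε * z * shiftedGenFun u (z ^ 2)) := by
    refine (hF.mul_left (ε * z)).congr_fun fun n => ?_
    rw [show 2 * n + 1 + 1 = 2 * (n + 1) by ring, hu.even _ (by omega)]
    push_cast
    ring
  -- The odd recurrence fails at n = 0, where it would give u₁ = ε instead of 1; this is the source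
  -- of the constant 1 − ε.
  have hcorr : HasSum (fun n : ℕ => if n = 0 then (1 - ε : ℝ) else 0) (1 - ε) :=
    hasSum_ite_eq 0 _
  have heven : HasSum (fun n : ℕ => (u (2 * n + 1) : ℝ) * z ^ (2 * n))
      (ε * (z ^ 2 * shiftedGenFun u (z ^ 2) + shiftedGenFun u (z ^ 2)) + (1 - ε)) := by
    refine (((hshift.add hF).mul_left (ε : ℝ)).add hcorr).congr_fun fun n => ?_
    rcases Nat.eq_zero_or_pos n with rfl | hn
    · simp [hu.zero, hu.one]
    · rw [hu.odd n hn, if_neg hn.ne', pow_mul]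
      push_cast
      ring
  have := (heven.even_add_odd (f := fun n : ℕ => (u (n + 1) : ℝ) * z ^ n) hodd).unique (hu.hasSum hz)
  rw [← this]
  ring

theorem exists_tail_le (hu : IsSternLike ε u) (M : ℕ) :
    ∃ K : ℝ, ∀ w : ℝ, |w| ≤ 1 / 2 →
      |shiftedGenFun u w - aeval w (shiftedTrunc u M)| ≤ K * |w| ^ M := by
  have hs : Summable fun n : ℕ => ((n + M + 1 : ℕ) : ℝ) * (1 / 2 : ℝ) ^ n := by
    have h1 : ‖(1 / 2 : ℝ)‖ < 1 := by norm_num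
    refine ((summable_pow_mul_geometric_of_norm_lt_one 1 h1).add
      ((summable_geometric_of_norm_lt_one h1).mul_left (M + 1 : ℝ))).congr fun n => ?_
    push_cast
    ring
  refine ⟨∑' n : ℕ, ((n + M + 1 : ℕ) : ℝ) * (1 / 2 : ℝ) ^ n, fun w hw => ?_⟩
  have h := (hasSum_nat_add_iff' M).2 (hu.hasSum (hw.trans_lt (by norm_num : (1 / 2 : ℝ) < 1)))
  have hpoly : aeval w (shiftedTrunc u M) = ∑ n ∈ Finset.range M, (u (n + 1) : ℝ) * w ^ n := by
    simp [shiftedTrunc, aeval_monomial]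
  rw [hpoly, ← h.tsum_eq, ← Real.norm_eq_abs]
  refine tsum_of_norm_bounded (hs.hasSum.mul_right (|w| ^ M)) fun n => ?_
  rw [norm_mul, norm_pow, Real.norm_eq_abs, Real.norm_eq_abs, pow_add, ← mul_assoc]
  have h3 : |(u (n + M + 1) : ℝ)| ≤ ((n + M + 1 : ℕ) : ℝ) := by
    exact_mod_cast hu.abs_le (n + M + 1)
  gcongr

theorem tendsto_zero (hu : IsSternLike ε u) :
    Tendsto (shiftedGenFun u) (𝓝 0) (𝓝 1) := by
  obtain ⟨K, hK⟩ := hu.exists_tail_le 1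
  rw [tendsto_iff_norm_sub_tendsto_zero]
  have h0 : Tendsto (fun w : ℝ => K * |w| ^ 1) (𝓝 0) (𝓝 0) := by
    have : Continuous fun w : ℝ => K * |w| ^ 1 := by fun_prop
    simpa using this.tendsto 0
  refine squeeze_zero' (Eventually.of_forall fun _ => norm_nonneg _) ?_ h0
  have hmem : Metric.closedBall (0 : ℝ) (1 / 2) ∈ 𝓝 (0 : ℝ) :=
    Metric.closedBall_mem_nhds _ (by norm_num)
  filter_upwards [hmem] with w hw
  have := hK w (by simpa using hw)
  simpa [shiftedTrunc, aeval_monomial, hu.one] using this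

end IsSternLike

/-! ### Iterating the functional equation -/

/-- The product `∏_{j<k} (1 + X^{2^j} + X^{2^{j+1}})`. -/
noncomputable def sternProd (k : ℕ) : ℤ[X] :=
  ∏ j ∈ Finset.range k, (1 + X ^ 2 ^ j + X ^ 2 ^ (j + 1))

/-- The polynomial `R_k` with `F(z) = R_k(z) + ε^k ∏_{j<k} (1 + z^{2^j} + z^{2^{j+1}}) F(z^{2^k})`. -/
noncomputable def sternRem (ε : ℤ) (k : ℕ) : ℤ[X] :=
  ∑ j ∈ Finset.range k, C ((1 - ε) * ε ^ j) * sternProd j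

theorem sternProd_succ (k : ℕ) :
    sternProd (k + 1) = sternProd k * (1 + X ^ 2 ^ k + X ^ 2 ^ (k + 1)) :=
  Finset.prod_range_succ _ _

/-- This bound and the one for `sternRem` dictate the asymmetric degrees D − 2, D, D − 1 in
`HasHermitePadeForm`: all three transformed coefficients then have degree at most D·2^k in z. -/
theorem natDegree_sternProd_add_two_le (k : ℕ) : (sternProd k).natDegree + 2 ≤ 2 * 2 ^ k := by
  induction k with
  | zero => simp [sternProd]
  | succ k ih =>
    rw [sternProd_succ]
    have h1 : (1 + X ^ 2 ^ k + X ^ 2 ^ (k + 1) : ℤ[X]).natDegree ≤ 2 ^ (k + 1) := by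
      have : 2 ^ k ≤ 2 ^ (k + 1) := Nat.pow_le_pow_right (by norm_num) (by omega)
      refine natDegree_add_le_of_degree_le (natDegree_add_le_of_degree_le ?_ ?_) ?_
      · simp
      · rw [natDegree_X_pow]; exact this
      · rw [natDegree_X_pow]
    have h2 := natDegree_mul_le_of_le (le_refl (sternProd k).natDegree) h1
    have h3 : 2 ^ (k + 1) = 2 * 2 ^ k := by ring
    omega

theorem natDegree_sternRem_le (ε : ℤ) (k : ℕ) : (sternRem ε k).natDegree ≤ 2 ^ k := by
  refine natDegree_sum_le_of_forall_le _ _ fun j hj => ?_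
  refine (natDegree_C_mul_le _ _).trans ?_
  have h1 := natDegree_sternProd_add_two_le j
  have h2 : 2 ^ (j + 1) ≤ 2 ^ k :=
    Nat.pow_le_pow_right (by norm_num) (Finset.mem_range.1 hj)
  have h3 : 2 ^ (j + 1) = 2 * 2 ^ j := by ring
  omega

theorem abs_pow_two_pow_lt_one {z : ℝ} (hz : |z| < 1) (k : ℕ) : |z ^ 2 ^ k| < 1 := by
  rw [abs_pow]
  exact pow_lt_one₀ (abs_nonneg z) hz (by positivity)

theorem IsSternLike.iterated_functional_equation {ε : ℤ} {u : ℕ → ℤ} (hu : IsSternLike ε u)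
    {z : ℝ} (hz : |z| < 1) (k : ℕ) :
    shiftedGenFun u z = aeval z (sternRem ε k) +
      ε ^ k * aeval z (sternProd k) * shiftedGenFun u (z ^ 2 ^ k) := by
  induction k with
  | zero => simp [sternRem, sternProd]
  | succ k ih =>
    have hrem : sternRem ε (k + 1) = sternRem ε k + C ((1 - ε) * ε ^ k) * sternProd k :=
      Finset.sum_range_succ _ _
    rw [ih, hu.functional_equation (abs_pow_two_pow_lt_one hz k), sternProd_succ, hrem,
      ← pow_mul, ← pow_succ]
    simp only [map_add, map_mul, map_one, map_pow, aeval_X, aeval_C, map_sub]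
    simp
    ring

/-- Each factor is 1 + x + x² with x real, which has negative discriminant. -/
theorem aeval_sternProd_pos (z : ℝ) (k : ℕ) : 0 < aeval z (sternProd k) := by
  rw [sternProd, map_prod]
  refine Finset.prod_pos fun j _ => ?_
  have h : z ^ 2 ^ (j + 1) = (z ^ 2 ^ j) ^ 2 := by rw [pow_succ, pow_mul]
  simp only [map_add, map_one, map_pow, aeval_X, h]
  nlinarith [sq_nonneg (z ^ 2 ^ j + 1), sq_nonneg (z ^ 2 ^ j)]

theorem tendsto_pow_two_pow {z : ℝ} (hz : |z| < 1) :
    Tendsto (fun k : ℕ => z ^ 2 ^ k) atTop (𝓝 0) :=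
  (tendsto_pow_atTop_nhds_zero_of_abs_lt_one hz).comp
    (tendsto_pow_atTop_atTop_of_one_lt (by norm_num))

/-- For ε = 1 the remainder is zero and the product is positive, so a zero at z would give zeros at
all z^(2^k), where the values tend to 1. -/
theorem shiftedGenFun_stern_ne_zero {z : ℝ} (hz : |z| < 1) : shiftedGenFun stern z ≠ 0 := by
  intro h0
  have h1 := isSternLike_stern.tendsto_zero.comp (tendsto_pow_two_pow hz)
  have h2 : (shiftedGenFun stern ∘ fun k : ℕ => z ^ 2 ^ k) = fun _ => 0 := by
    funext k
    have h3 := isSternLike_stern.iterated_functional_equation hz k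
    rw [h0] at h3
    simpa [sternRem, (aeval_sternProd_pos z k).ne'] using h3
  rw [h2] at h1
  exact zero_ne_one (tendsto_nhds_unique tendsto_const_nhds h1)

theorem tendsto_aeval_sternProd {z : ℝ} (hz : |z| < 1) :
    Tendsto (fun k => aeval z (sternProd k)) atTop (𝓝 (shiftedGenFun stern z)) := by
  have h1 := isSternLike_stern.tendsto_zero.comp (tendsto_pow_two_pow hz)
  have h2 := (tendsto_const_nhds (x := shiftedGenFun stern z)).div h1 one_ne_zero
  rw [div_one] at h2
  refine h2.congr fun k => ?_
  have h3 := isSternLike_stern.iterated_functional_equation hz k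
  have h4 := shiftedGenFun_stern_ne_zero (abs_pow_two_pow_lt_one hz k)
  simp only [Pi.div_apply, Function.comp_apply]
  rw [div_eq_iff h4, h3]
  simp [sternRem]

theorem exists_int_eq_pow_mul_aeval {P : ℤ[X]} {m : ℕ} (hP : P.natDegree ≤ m) (a : ℤ) {b : ℕ}
    (hb : b ≠ 0) : ∃ n : ℤ, (n : ℝ) = (b : ℝ) ^ m * aeval ((a : ℝ) / b) P := by
  have hb' : (b : ℝ) ≠ 0 := by exact_mod_cast hb
  have bu : (b : ℝ)⁻¹ * Int.castRingHom ℝ (b : ℤ) = 1 := by simp [hb']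
  obtain ⟨n, bi, hbi, hn⟩ := denomsClearable_of_natDegree_le m a bu P hP
  have hbi' : bi = (b : ℝ)⁻¹ := by
    exact eq_inv_of_mul_eq_one_left (by simpa using hbi)
  refine ⟨n, ?_⟩
  rw [hbi', eval_map] at hn
  simpa [aeval_def, div_eq_mul_inv] using hn

/-! ### From Hermite–Padé forms to integer linear forms -/

/-- There is a linear form in `1, A, B` with polynomial coefficients of degrees at most
`D - 2, D, D - 1` that vanishes to order exactly `N` at the origin. -/
def HasHermitePadeForm (D N : ℕ) : Prop :=
  ∃ C₀ C₁ C₂ : ℤ[X], C₀.natDegree + 2 ≤ D ∧ C₁.natDegree ≤ D ∧ C₂.natDegree + 1 ≤ D ∧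
    ∃ r : ℝ, r ≠ 0 ∧ Tendsto (fun w : ℝ => (aeval w C₀ + aeval w C₁ * shiftedGenFun stern w +
      aeval w C₂ * shiftedGenFun twistedStern w) / w ^ N) (𝓝[≠] 0) (𝓝 r)

/-- For all large `k` there is an integer linear form in `1, α, β` with coefficients of size at most
`C b ^ (D 2 ^ k)` whose value has size `b ^ (-(N θ - D) 2 ^ k)` up to the factor `C`. -/
def HasIntegerForms (α β b θ : ℝ) (D N : ℕ) (K : ℝ) : Prop :=
  ∀ᶠ k : ℕ in atTop, ∃ c₀ c₁ c₂ : ℤ,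
    |(c₁ : ℝ)| ≤ K * b ^ ((D : ℝ) * 2 ^ k) ∧ |(c₂ : ℝ)| ≤ K * b ^ ((D : ℝ) * 2 ^ k) ∧
    b ^ (-((N * θ - D) * 2 ^ k)) ≤ K * |c₀ + c₁ * α + c₂ * β| ∧
    |c₀ + c₁ * α + c₂ * β| ≤ K * b ^ (-((N * θ - D) * 2 ^ k))

/-- The forms at level k + 1 for (D, N) serve at level k for (2D, 2N). -/
theorem HasIntegerForms.double {α β b θ : ℝ} {D N : ℕ} {K : ℝ}
    (h : HasIntegerForms α β b θ D N K) : HasIntegerForms α β b θ (2 * D) (2 * N) K := by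
  filter_upwards [(tendsto_add_atTop_nat 1).eventually h] with k hk
  have h1 : ((2 * D : ℕ) : ℝ) * 2 ^ k = D * 2 ^ (k + 1) := by push_cast; ring
  have h2 : (((2 * N : ℕ) : ℝ) * θ - (2 * D : ℕ)) * 2 ^ k = (N * θ - D) * 2 ^ (k + 1) := by
    push_cast; ring
  rw [h1, h2]
  exact hk

/-- Stated for all large K, so that finitely many pairs (D, N) can share one constant. -/
theorem HasHermitePadeForm.eventually_hasIntegerForms {D N : ℕ} (h : HasHermitePadeForm D N)
    {a : ℤ} {b : ℕ} {θ : ℝ} (hb : 2 ≤ b) (hθ : 0 < θ)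
    (hz : |(a : ℝ) / b| = (b : ℝ) ^ (-θ)) :
    ∀ᶠ K : ℝ in atTop, HasIntegerForms (shiftedGenFun stern ((a : ℝ) / b))
      (shiftedGenFun twistedStern ((a : ℝ) / b)) b θ D N K := by
  obtain ⟨C₀, C₁, C₂, hC₀, hC₁, hC₂, r, hr, hlim⟩ := h
  have hb0 : b ≠ 0 := by omega
  have hb1 : (1 : ℝ) < b := by exact_mod_cast (by omega : 1 < b)
  have hbpos : (0 : ℝ) < b := by linarith
  set z : ℝ := (a : ℝ) / b with hzdef
  have hz1 : |z| < 1 := by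
    rw [hz]
    exact Real.rpow_lt_one_of_one_lt_of_neg hb1 (by linarith)
  have hz0 : z ≠ 0 := by
    rw [← abs_pos, hz]
    positivity
  have hw := tendsto_pow_two_pow hz1
  have hw' : Tendsto (fun k : ℕ => z ^ 2 ^ k) atTop (𝓝[≠] 0) :=
    tendsto_nhdsWithin_iff.2 ⟨hw, Eventually.of_forall fun k => pow_ne_zero _ hz0⟩
  have hG := ((tendsto_aeval_sternProd hz1).mul (hlim.comp hw')).abs
  have hG0 : 0 < |shiftedGenFun stern z * r| :=
    abs_pos.2 (mul_ne_zero (shiftedGenFun_stern_ne_zero hz1) hr)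
  have hlimC : ∀ P : ℤ[X], Tendsto (fun k : ℕ => |aeval (z ^ 2 ^ k) P|) atTop
      (𝓝 |aeval (0 : ℝ) P|) := fun P =>
    ((P.continuous_aeval.tendsto 0).comp hw).abs
  -- K exceeds the limits of |C₁(w)|, |C₂(w)|, |G| and 1/|G|, where G is P_k(z) times the form at w
  -- divided by w^N.
  filter_upwards [eventually_gt_atTop |aeval (0 : ℝ) C₁|, eventually_gt_atTop |aeval (0 : ℝ) C₂|,
    eventually_gt_atTop |shiftedGenFun stern z * r|,
    (tendsto_inv_atTop_zero (𝕜 := ℝ)).eventually (gt_mem_nhds hG0), eventually_gt_atTop 0]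
    with K hK1 hK2 hK3 hK4 hK0
  filter_upwards [(hlimC C₁).eventually (gt_mem_nhds hK1), (hlimC C₂).eventually (gt_mem_nhds hK2),
    hG.eventually (gt_mem_nhds hK3), hG.eventually (lt_mem_nhds hK4)] with k h1 h2 h3 h4
  have hpow : (b : ℝ) ^ ((D : ℝ) * 2 ^ k) = (b : ℝ) ^ (D * 2 ^ k) := by
    rw [← Real.rpow_natCast (b : ℝ) (D * 2 ^ k), Nat.cast_mul, Nat.cast_pow, Nat.cast_two]
  have hdegE : ∀ P : ℤ[X], ∀ d, P.natDegree ≤ d → (expand ℤ (2 ^ k) P).natDegree ≤ d * 2 ^ k :=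
    fun P d hd => by rw [natDegree_expand]; exact Nat.mul_le_mul_right _ hd
  obtain ⟨c₁, hc₁⟩ := exists_int_eq_pow_mul_aeval (hdegE C₁ D hC₁) a hb0
  have hdeg₂ : (C ((-1) ^ k) * expand ℤ (2 ^ k) C₂ : ℤ[X]).natDegree ≤ D * 2 ^ k :=
    (natDegree_C_mul_le _ _).trans (hdegE C₂ D (by omega))
  obtain ⟨c₂, hc₂⟩ := exists_int_eq_pow_mul_aeval hdeg₂ a hb0
  -- Eliminating B(w) through B(z) − R_k(z) moves a multiple of R_k into the constant coefficient;
  -- the sign (−1)^k is its own inverse.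
  have hdeg₀ : (sternProd k * expand ℤ (2 ^ k) C₀ -
      C ((-1) ^ k) * expand ℤ (2 ^ k) C₂ * sternRem (-1) k : ℤ[X]).natDegree ≤ D * 2 ^ k := by
    refine (natDegree_sub_le_of_le (le_refl _) (le_refl _)).trans (max_le ?_ ?_)
    · have h5 := natDegree_mul_le_of_le (le_refl (sternProd k).natDegree)
        (hdegE C₀ (D - 2) (by omega))
      have h6 := natDegree_sternProd_add_two_le k
      obtain ⟨d, rfl⟩ := Nat.exists_eq_add_of_le' (show 2 ≤ D by omega)
      rw [Nat.add_sub_cancel] at h5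
      rw [add_mul]
      omega
    · have h5 := natDegree_mul_le_of_le
        ((natDegree_C_mul_le ((-1) ^ k) _).trans (hdegE C₂ (D - 1) (by omega)))
        (natDegree_sternRem_le (-1) k)
      obtain ⟨d, rfl⟩ := Nat.exists_eq_add_of_le' (show 1 ≤ D by omega)
      rw [Nat.add_sub_cancel] at h5
      rw [add_mul]
      omega
  obtain ⟨c₀, hc₀⟩ := exists_int_eq_pow_mul_aeval hdeg₀ a hb0
  have hA := isSternLike_stern.iterated_functional_equation hz1 k
  have hB := isSternLike_twistedStern.iterated_functional_equation hz1 k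
  rw [← hzdef] at hc₀ hc₁ hc₂
  simp only [map_sub, map_mul, expand_aeval, aeval_C] at hc₀ hc₁ hc₂
  simp only [map_pow, map_neg, map_one] at hc₀ hc₁ hc₂
  have hsign : ((-1 : ℝ) ^ k) * (-1) ^ k = 1 := by
    rw [← mul_pow]; norm_num
  have hL : (c₀ : ℝ) + c₁ * shiftedGenFun stern z + c₂ * shiftedGenFun twistedStern z =
      (b : ℝ) ^ (D * 2 ^ k) * (aeval z (sternProd k) * (aeval (z ^ 2 ^ k) C₀ +
        aeval (z ^ 2 ^ k) C₁ * shiftedGenFun stern (z ^ 2 ^ k) +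
        aeval (z ^ 2 ^ k) C₂ * shiftedGenFun twistedStern (z ^ 2 ^ k))) := by
    have hA' : shiftedGenFun stern z =
        aeval z (sternProd k) * shiftedGenFun stern (z ^ 2 ^ k) := by
      rw [hA]; simp [sternRem]
    rw [hc₀, hc₁, hc₂, hA', hB]
    push_cast
    linear_combination (b : ℝ) ^ (D * 2 ^ k) * aeval (z ^ 2 ^ k) C₂ * aeval z (sternProd k) *
      shiftedGenFun twistedStern (z ^ 2 ^ k) * hsign
  simp only [Function.comp_apply] at h3 h4
  set G := aeval z (sternProd k) * ((aeval (z ^ 2 ^ k) C₀ +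
        aeval (z ^ 2 ^ k) C₁ * shiftedGenFun stern (z ^ 2 ^ k) +
        aeval (z ^ 2 ^ k) C₂ * shiftedGenFun twistedStern (z ^ 2 ^ k)) / (z ^ 2 ^ k) ^ N) with hGdef
  have hwN : |(z ^ 2 ^ k) ^ N| = (b : ℝ) ^ (-(N * θ * 2 ^ k)) := by
    rw [abs_pow, abs_pow, hz, ← Real.rpow_natCast, ← Real.rpow_natCast, ← Real.rpow_mul hbpos.le,
      ← Real.rpow_mul hbpos.le]
    congr 1
    push_cast
    ring
  have hL' : |(c₀ : ℝ) + c₁ * shiftedGenFun stern z + c₂ * shiftedGenFun twistedStern z| =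
      (b : ℝ) ^ (-((N * θ - D) * 2 ^ k)) * |G| := by
    have hw0 : (z ^ 2 ^ k) ^ N ≠ 0 := pow_ne_zero _ (pow_ne_zero _ hz0)
    have e1 : (b : ℝ) ^ (-((N * θ - D) * 2 ^ k)) = (b : ℝ) ^ (D * 2 ^ k) * |(z ^ 2 ^ k) ^ N| := by
      rw [hwN, ← hpow, ← Real.rpow_add hbpos]
      congr 1
      ring
    rw [hL, e1, hGdef, ← abs_of_pos (pow_pos hbpos (D * 2 ^ k)), ← abs_mul, ← abs_mul]
    congr 1
    rw [abs_of_pos (pow_pos hbpos (D * 2 ^ k))]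
    field_simp
  have hbD : 0 < (b : ℝ) ^ (D * 2 ^ k) := pow_pos hbpos _
  have hbE : 0 < (b : ℝ) ^ (-((N * θ - D) * 2 ^ k)) := Real.rpow_pos_of_pos hbpos _
  refine ⟨c₀, c₁, c₂, ?_, ?_, ?_, ?_⟩
  · rw [hc₁, hpow, abs_mul, abs_of_pos hbD, mul_comm]
    gcongr
  · rw [hc₂, hpow, abs_mul, abs_of_pos hbD, mul_comm, abs_mul]
    simp only [abs_pow, abs_neg, abs_one, one_pow, one_mul]
    gcongr
  · rw [hL']
    have h5 : 1 ≤ K * |G| := by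
      rw [inv_lt_iff_one_lt_mul₀ hK0] at h4
      linarith
    nlinarith
  · rw [hL', mul_comm]
    gcongr

/-! ### Excluding good approximations window by window -/

/-- One step of the window argument: two linear forms of consecutive quality exclude good
simultaneous approximations whose denominator lies between them. -/
theorem not_approx_of_form {α β b : ℝ} (hb : 1 < b) {e e' d' ν μ K t q : ℝ} {p₁ p₂ c₀ c₁ c₂ : ℤ}
    {Q : ℤ} (hqQ : q = Q) (hq : 1 ≤ q) (hK : 1 ≤ K) (ht : 0 ≤ t) (hν : 1 ≤ ν)
    (hd' : d' ≤ (ν - 1) * e) (he' : e' + d' ≤ ν * e)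
    (hc₁ : |(c₁ : ℝ)| ≤ K * b ^ (d' * t)) (hc₂ : |(c₂ : ℝ)| ≤ K * b ^ (d' * t))
    (hlow : b ^ (-(e' * t)) ≤ K * |c₀ + c₁ * α + c₂ * β|)
    (hup : |c₀ + c₁ * α + c₂ * β| ≤ K * b ^ (-(e' * t)))
    (hwin : b ^ (e * t) ≤ 2 * K * q) (hwin' : 2 * K * q < b ^ (e' * t))
    (hq1 : 2 * K * (2 * K) ^ (ν - 1) * q ^ (ν - μ) < 1 / 2)
    (hq2 : 2 * K ^ 2 * (2 * K) ^ ν * q ^ (ν - μ) < 1)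
    (h₁ : |α - p₁ / q| < 1 / q ^ μ) (h₂ : |β - p₂ / q| < 1 / q ^ μ) : False := by
  have hb0 : 0 < b := by linarith
  have hq0 : 0 < q := by linarith
  have hK0 : 0 < K := by linarith
  have hy0 : 0 < 2 * K * q := by positivity
  have hqμ : 0 < q ^ μ := Real.rpow_pos_of_pos hq0 μ
  -- The lower end of the window converts powers of b into powers of 2Kq.
  have hpowle : ∀ x s : ℝ, 0 ≤ s → x ≤ s * e → b ^ (x * t) ≤ (2 * K) ^ s * q ^ s := by
    intro x s hs hx
    calc b ^ (x * t) ≤ b ^ (e * t * s) :=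
          Real.rpow_le_rpow_of_exponent_le hb.le (by nlinarith)
      _ = (b ^ (e * t)) ^ s := Real.rpow_mul hb0.le _ _
      _ ≤ (2 * K * q) ^ s := Real.rpow_le_rpow (by positivity) hwin hs
      _ = _ := Real.mul_rpow (by positivity) hq0.le
  set L : ℝ := c₀ + c₁ * α + c₂ * β with hL
  set Λ : ℤ := Q * c₀ + p₁ * c₁ + p₂ * c₂ with hΛ
  have hsplit : (Λ : ℝ) = q * L - q * (c₁ * (α - p₁ / q) + c₂ * (β - p₂ / q)) := by
    rw [hΛ, hL]
    push_cast
    rw [← hqQ]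
    field_simp
    ring
  have herr : |c₁ * (α - p₁ / q) + c₂ * (β - p₂ / q)| ≤ 2 * K * b ^ (d' * t) * (1 / q ^ μ) := by
    refine (abs_add_le _ _).trans ?_
    rw [abs_mul, abs_mul]
    have i1 := mul_le_mul hc₁ h₁.le (abs_nonneg _) (by positivity)
    have i2 := mul_le_mul hc₂ h₂.le (abs_nonneg _) (by positivity)
    linarith
  have hbe' : 0 < b ^ (e' * t) := Real.rpow_pos_of_pos hb0 _
  -- If Λ = 0, the form's value equals the approximation error, and its lower bound forces q^μ to be
  -- at most a constant times b^((e'+d')t), hence times q^ν.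
  by_cases h0 : Λ = 0
  · have h3 : L = c₁ * (α - p₁ / q) + c₂ * (β - p₂ / q) := by
      rw [h0, Int.cast_zero, eq_comm, sub_eq_zero] at hsplit
      exact mul_left_cancel₀ hq0.ne' hsplit
    rw [← h3] at herr
    have h4 : b ^ (-(e' * t)) ≤ 2 * K ^ 2 * b ^ (d' * t) * (1 / q ^ μ) := by
      refine hlow.trans ((mul_le_mul_of_nonneg_left herr hK0.le).trans_eq ?_)
      ring
    have h5 : 1 ≤ 2 * K ^ 2 * b ^ ((e' + d') * t) * (1 / q ^ μ) := by
      have := mul_le_mul_of_nonneg_left h4 hbe'.le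
      rw [← Real.rpow_add hb0, add_neg_cancel, Real.rpow_zero] at this
      refine this.trans_eq ?_
      rw [add_mul, Real.rpow_add hb0]
      ring
    have h6 : 2 * K ^ 2 * b ^ ((e' + d') * t) * (1 / q ^ μ) ≤
        2 * K ^ 2 * ((2 * K) ^ ν * q ^ ν) * (1 / q ^ μ) := by
      have := hpowle (e' + d') ν (by linarith) he'
      gcongr
    have h7 : q ^ (ν - μ) = q ^ ν * (1 / q ^ μ) := by
      rw [Real.rpow_sub hq0]; ring
    rw [h7] at hq2
    nlinarith
  -- If Λ ≠ 0, both parts of `hsplit` are below 1/2: the first by the upper end of the window, the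
  -- second because d' ≤ (ν − 1)e.
  · have h3 : (1 : ℝ) ≤ |(Λ : ℝ)| := by
      exact_mod_cast Int.one_le_abs h0
    have h4 : q * |L| < 1 / 2 := by
      have i1 : q * |L| ≤ q * (K * b ^ (-(e' * t))) := mul_le_mul_of_nonneg_left hup hq0.le
      have i2 : 2 * K * q * b ^ (-(e' * t)) < 1 := by
        rw [Real.rpow_neg hb0.le, ← div_eq_mul_inv, div_lt_one hbe']
        exact hwin'
      linarith
    have h5 : |(Λ : ℝ)| ≤ q * |L| + q * (2 * K * b ^ (d' * t) * (1 / q ^ μ)) := by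
      rw [hsplit]
      refine (abs_sub _ _).trans ?_
      rw [abs_mul, abs_mul, abs_of_pos hq0]
      gcongr
    have h6 : q * (2 * K * b ^ (d' * t) * (1 / q ^ μ)) ≤
        q * (2 * K * ((2 * K) ^ (ν - 1) * q ^ (ν - 1)) * (1 / q ^ μ)) := by
      have := hpowle d' (ν - 1) (by linarith) hd'
      gcongr
    have h7 : q ^ (ν - μ) = q * q ^ (ν - 1) * (1 / q ^ μ) := by
      rw [Real.rpow_sub hq0, ← Real.rpow_one_add' hq0.le (by linarith)]
      ring_nf
    rw [h7] at hq1
    linarith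

/-- With e_j = N_jθ − D_j, closure under doubling gives e_J = 2e_0, so the windows between b^(e_j
2^k) and b^(e_{j+1} 2^k), for j < J and k ≥ k₀, leave no gap above b^(e_0 2^k₀). -/
theorem exists_forall_not_approx {α β b θ ν μ : ℝ} (hb : 1 < b) (J : ℕ) (D N : ℕ → ℕ)
    (hD : D J = 2 * D 0) (hN : N J = 2 * N 0)
    (hforms : ∀ j ≤ J, ∀ᶠ K : ℝ in atTop, HasIntegerForms α β b θ (D j) (N j) K)
    (hpos : 0 < N 0 * θ - D 0) (hν : 1 ≤ ν) (hνμ : ν < μ)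
    (hstepD : ∀ j < J, (D (j + 1) : ℝ) ≤ (ν - 1) * (N j * θ - D j))
    (hstepN : ∀ j < J, (N (j + 1) : ℝ) * θ ≤ ν * (N j * θ - D j)) :
    ∃ Q₀ : ℕ, ∀ q : ℕ, Q₀ ≤ q → ∀ p₁ p₂ : ℤ,
      ¬ (|α - p₁ / q| < 1 / (q : ℝ) ^ μ ∧ |β - p₂ / q| < 1 / (q : ℝ) ^ μ) := by
  have hb0 : 0 < b := by linarith
  obtain ⟨K, hKf, hK1⟩ := (((Finset.range (J + 1)).eventually_all.2 fun j hj =>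
    hforms j (Nat.lt_succ_iff.1 (Finset.mem_range.1 hj))).and (eventually_ge_atTop 1)).exists
  obtain ⟨k₀, hk₀⟩ := eventually_atTop.1 ((Finset.range (J + 1)).eventually_all.2 hKf)
  set e : ℕ → ℝ := fun j => N j * θ - D j with he
  have heJ : e J = 2 * e 0 := by
    simp only [he, hD, hN]
    push_cast
    ring
  have hK0 : 0 < K := by linarith
  have hsmall : Tendsto (fun q : ℕ => (q : ℝ) ^ (ν - μ)) atTop (𝓝 0) := by
    have := (tendsto_rpow_neg_atTop (sub_pos.2 hνμ)).comp (tendsto_natCast_atTop_atTop (R := ℝ))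
    refine this.congr fun q => ?_
    simp [neg_sub]
  have hs1 : ∀ᶠ q : ℕ in atTop, 2 * K * (2 * K) ^ (ν - 1) * (q : ℝ) ^ (ν - μ) < 1 / 2 := by
    refine (hsmall.const_mul _).eventually (gt_mem_nhds ?_)
    norm_num
  have hs2 : ∀ᶠ q : ℕ in atTop, 2 * K ^ 2 * (2 * K) ^ ν * (q : ℝ) ^ (ν - μ) < 1 := by
    refine (hsmall.const_mul _).eventually (gt_mem_nhds ?_)
    norm_num
  have hs3 : ∀ᶠ q : ℕ in atTop, b ^ (e 0 * 2 ^ k₀) ≤ 2 * K * (q : ℝ) :=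
    (tendsto_natCast_atTop_atTop.const_mul_atTop (by positivity)).eventually_ge_atTop _
  obtain ⟨Q₀, hQ₀⟩ := eventually_atTop.1 (((hs1.and hs2).and hs3).and (eventually_ge_atTop 1))
  refine ⟨Q₀, fun q hq p₁ p₂ ⟨h₁, h₂⟩ => ?_⟩
  obtain ⟨⟨⟨hq1, hq2⟩, hq3⟩, hq4⟩ := hQ₀ q hq
  have hunb : ∃ k : ℕ, 2 * K * q < b ^ (e 0 * 2 ^ (k₀ + k)) := by
    have h1 : Tendsto (fun k : ℕ => e 0 * (2 : ℝ) ^ (k₀ + k)) atTop atTop :=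
      ((tendsto_pow_atTop_atTop_of_one_lt one_lt_two).comp
        (tendsto_atTop_mono (fun k => Nat.le_add_left k k₀) tendsto_id)).const_mul_atTop hpos
    exact (((tendsto_rpow_atTop_of_base_gt_one b hb).comp h1).eventually_gt_atTop _).exists
  classical
  obtain ⟨k, hk, hkw, hkw'⟩ : ∃ k, k₀ ≤ k ∧ b ^ (e 0 * 2 ^ k) ≤ 2 * K * q ∧
      2 * K * q < b ^ (e J * 2 ^ k) := by
    have h1 := Nat.find_spec hunb
    have h0 : Nat.find hunb ≠ 0 := by
      intro h
      rw [h, add_zero] at h1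
      exact absurd h1 (not_lt.2 hq3)
    obtain ⟨m, hm⟩ := Nat.exists_eq_succ_of_ne_zero h0
    refine ⟨k₀ + m, by omega, not_lt.1 (Nat.find_min hunb (m := m) (by omega)), ?_⟩
    rw [hm] at h1
    convert h1 using 2
    rw [heJ, Nat.succ_eq_add_one, ← add_assoc, pow_succ]
    ring
  -- The least such index is positive, so its predecessor supplies the lower end of the window; no
  -- monotonicity of e is needed.
  have hexj : ∃ j, 2 * K * q < b ^ (e j * 2 ^ k) := ⟨J, hkw'⟩
  have hj1 := Nat.find_spec hexj
  have hjJ : Nat.find hexj ≤ J := Nat.find_min' hexj hkw'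
  have hj0 : Nat.find hexj ≠ 0 := by
    intro h
    rw [h] at hj1
    exact absurd hj1 (not_lt.2 hkw)
  obtain ⟨j, hj⟩ := Nat.exists_eq_succ_of_ne_zero hj0
  have hj2 : b ^ (e j * 2 ^ k) ≤ 2 * K * q := not_lt.1 (Nat.find_min hexj (m := j) (by omega))
  rw [hj, Nat.succ_eq_add_one] at hj1
  obtain ⟨c₀, c₁, c₂, hc₁, hc₂, hlow, hup⟩ := hk₀ k hk (j + 1) (Finset.mem_range.2 (by omega))
  refine not_approx_of_form hb (e := e j) (e' := e (j + 1)) (d' := D (j + 1)) (ν := ν) (μ := μ)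
    (K := K) (t := 2 ^ k) (q := q) (Q := q) (c₀ := c₀) (by simp) (by exact_mod_cast hq4) hK1
    (by positivity) hν (hstepD j (by omega)) ?_ hc₁ hc₂ hlow hup hj2 hj1 hq1 hq2 h₁ h₂
  have := hstepN j (by omega)
  simp only [he]
  linarith

/-! ### Bounding the approximation exponent -/

/-- Only q < Q₀ remain, and as 1/q^μ ≤ 1 the numerators are bounded too. -/
theorem finite_simApproxSolutions {α β μ : ℝ} (hμ : 0 ≤ μ) {Q₀ : ℕ}
    (h : ∀ q : ℕ, Q₀ ≤ q → ∀ p₁ p₂ : ℤ,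
      ¬ (|α - p₁ / q| < 1 / (q : ℝ) ^ μ ∧ |β - p₂ / q| < 1 / (q : ℝ) ^ μ)) :
    (simApproxSolutions ![α, β] μ).Finite := by
  set M : ℤ := ⌈(Q₀ : ℝ) * (|α| + |β| + 1)⌉ with hM
  have hbound : ∀ (x : ℝ) (q : ℕ) (p : ℤ), |x| ≤ |α| + |β| → 1 ≤ q → q < Q₀ →
      |x - p / q| < 1 / (q : ℝ) ^ μ → p ∈ Set.Icc (-M) M := by
    intro x q p hx hq1 hq hp
    have hq1' : (1 : ℝ) ≤ q := by exact_mod_cast hq1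
    have hq' : (q : ℝ) ≤ Q₀ := by exact_mod_cast hq.le
    have h1 : 1 / (q : ℝ) ^ μ ≤ 1 := by
      rw [div_le_one (by positivity)]
      exact Real.one_le_rpow hq1' hμ
    have h2 : |(p : ℝ) / q| ≤ |α| + |β| + 1 := by
      have := abs_sub_abs_le_abs_sub ((p : ℝ) / q) x
      rw [abs_sub_comm] at this
      linarith
    have h3 : |(p : ℝ)| ≤ Q₀ * (|α| + |β| + 1) := by
      rw [abs_div, Nat.abs_cast, div_le_iff₀ (by positivity)] at h2
      refine h2.trans ?_
      rw [mul_comm]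
      gcongr
    have h4 : |p| ≤ M := by
      have := h3.trans (Int.le_ceil _)
      exact_mod_cast this
    exact abs_le.1 h4
  refine (((Set.finite_Iio Q₀).prod ((Set.finite_Icc (-M) M).prod (Set.finite_Icc (-M) M))).image
    fun x : ℕ × ℤ × ℤ => (![(x.2.1 : ℚ) / x.1, (x.2.2 : ℚ) / x.1] : Fin 2 → ℚ)).subset ?_
  rintro r ⟨q, p, hq, hr, hp⟩
  have hp0 : |α - p 0 / q| < 1 / (q : ℝ) ^ μ := by simpa using hp 0
  have hp1 : |β - p 1 / q| < 1 / (q : ℝ) ^ μ := by simpa using hp 1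
  have hqQ : q < Q₀ := by
    by_contra hcon
    exact h q (not_lt.1 hcon) (p 0) (p 1) ⟨hp0, hp1⟩
  refine ⟨(q, p 0, p 1), ⟨hqQ, hbound α q _ ?_ hq hqQ hp0, hbound β q _ ?_ hq hqQ hp1⟩, ?_⟩
  · linarith [abs_nonneg β]
  · linarith [abs_nonneg α]
  · funext i
    fin_cases i
    · simp [hr]
    · simp [hr]

theorem simApproxExponent_le {α β ν : ℝ} (hν : 0 ≤ ν)
    (h : ∀ μ, ν < μ → ∃ Q₀ : ℕ, ∀ q : ℕ, Q₀ ≤ q → ∀ p₁ p₂ : ℤ,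
      ¬ (|α - p₁ / q| < 1 / (q : ℝ) ^ μ ∧ |β - p₂ / q| < 1 / (q : ℝ) ^ μ)) :
    simApproxExponent ![α, β] ≤ (ν : EReal) := by
  refine sSup_le ?_
  rintro _ ⟨μ, rfl, hinf⟩
  rw [EReal.coe_le_coe_iff]
  by_contra hcon
  obtain ⟨Q₀, hQ₀⟩ := h μ (not_le.1 hcon)
  exact hinf (finite_simApproxSolutions (by linarith) hQ₀)

/-! ### Verifying Hermite–Padé forms by computation on lists -/

/-- The polynomial with the given list of coefficients. -/
noncomputable def listPoly : List ℤ → ℤ[X]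
  | [] => 0
  | x :: xs => C x + X * listPoly xs

/-- The inner product of two lists, the longer one being truncated. -/
def listDot : List ℤ → List ℤ → ℤ
  | x :: xs, y :: ys => x * y + listDot xs ys
  | _, _ => 0

theorem listDot_nil_right (c : List ℤ) : listDot c [] = 0 := by
  cases c <;> rfl

theorem natDegree_listPoly_add_one_le {c : List ℤ} {d : ℕ} (hc : c.length ≤ d + 1) :
    (listPoly c).natDegree ≤ d := by
  induction c generalizing d with
  | nil => simp [listPoly]
  | cons x xs ih =>
    rw [listPoly]
    refine natDegree_add_le_of_degree_le (by simp) ?_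
    rcases d with _ | d
    · have : xs = [] := List.length_eq_zero_iff.1 (by simpa using hc)
      simp [this, listPoly]
    · have h1 := natDegree_mul_le_of_le (natDegree_X_le (R := ℤ)) (ih (d := d) (by simpa using hc))
      omega

theorem coeff_listPoly_mul (c : List ℤ) (P : ℤ[X]) (n : ℕ) :
    (listPoly c * P).coeff n =
      listDot c ((List.range (n + 1)).map fun i => P.coeff (n - i)) := by
  induction c generalizing n with
  | nil => simp [listPoly, listDot]
  | cons x xs ih =>
    rw [listPoly, add_mul, mul_assoc, coeff_add, coeff_C_mul]
    rcases n with _ | n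
    · simp [listDot, listDot_nil_right]
    · rw [coeff_X_mul, ih, List.range_succ_eq_map (n := n + 1)]
      simp [listDot, Function.comp_def]

theorem coeff_shiftedTrunc (u : ℕ → ℤ) {M i : ℕ} (hi : i < M) :
    (shiftedTrunc u M).coeff i = u (i + 1) := by
  simp [shiftedTrunc, coeff_monomial, hi]

/-- Stern-like sequences computed by structural recursion on a bound for the argument. -/
def sternFuel (ε : ℤ) : ℕ → ℕ → ℤ
  | 0, _ => 0
  | f + 1, n =>
    if n = 0 then 0 else if n = 1 then 1 else
    if n % 2 = 0 then ε * sternFuel ε f (n / 2)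
    else ε * (sternFuel ε f (n / 2) + sternFuel ε f (n / 2 + 1))

theorem IsSternLike.sternFuel_eq {ε : ℤ} {u : ℕ → ℤ} (hu : IsSternLike ε u) {f n : ℕ}
    (h : n ≤ f) : sternFuel ε f n = u n := by
  induction f generalizing n with
  | zero => rw [Nat.le_zero.1 h, hu.zero, sternFuel]
  | succ f ih =>
    rw [sternFuel]
    split_ifs with h0 h1 h2
    · rw [h0, hu.zero]
    · rw [h1, hu.one]
    · rw [ih (by omega), ← hu.even _ (by omega), Nat.mul_div_cancel' (Nat.dvd_of_mod_eq_zero h2)]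
    · rw [ih (by omega), ih (by omega), ← hu.odd _ (by omega)]
      congr 1
      omega

/-- Reversing an initial segment turns the convolution in `coeff_listPoly_mul` into a plain inner
product. -/
theorem IsSternLike.reverse_take_eq {ε : ℤ} {u : ℕ → ℤ} (hu : IsSternLike ε u) {s : List ℤ} {L : ℕ}
    (hs : s = (List.range L).map fun i => sternFuel ε L (i + 1)) {n : ℕ} (hn : n < L) :
    (s.take (n + 1)).reverse =
      (List.range (n + 1)).map fun i => (shiftedTrunc u L).coeff (n - i) := by
  subst hs
  refine List.ext_getElem (by simp; omega) fun i h1 h2 => ?_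
  have hi : i < n + 1 := by simpa using h2
  simp only [List.getElem_reverse, List.getElem_take, List.getElem_map, List.getElem_range,
    List.length_take, List.length_map, List.length_range]
  rw [coeff_shiftedTrunc u (by omega), hu.sternFuel_eq (by omega)]
  congr 1
  omega

/-- Coefficients of degree M > N and beyond do not affect the limit after division by w^N, so finite
truncations decide the order. -/
theorem IsSternLike.tendsto_tail {ε : ℤ} {u : ℕ → ℤ} (hu : IsSternLike ε u) (P : ℤ[X]) {N M : ℕ}
    (hNM : N < M) :
    Tendsto (fun w : ℝ => aeval w P * (shiftedGenFun u w - aeval w (shiftedTrunc u M)) / w ^ N)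
      (𝓝[≠] 0) (𝓝 0) := by
  obtain ⟨K, hK⟩ := hu.exists_tail_le M
  have h0 : Tendsto (fun w : ℝ => |aeval w P| * (K * |w| ^ (M - N))) (𝓝[≠] 0) (𝓝 0) := by
    have h1 : Continuous fun w : ℝ => |aeval w P| * (K * |w| ^ (M - N)) := by
      have := P.continuous_aeval (A := ℝ)
      fun_prop
    have h2 := h1.tendsto 0
    simp only [abs_zero, zero_pow (Nat.sub_ne_zero_of_lt hNM), mul_zero] at h2
    exact h2.mono_left nhdsWithin_le_nhds
  refine squeeze_zero_norm' ?_ h0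
  have hmem : Metric.closedBall (0 : ℝ) (1 / 2) ∈ 𝓝[≠] (0 : ℝ) :=
    mem_nhdsWithin_of_mem_nhds (Metric.closedBall_mem_nhds _ (by norm_num))
  filter_upwards [hmem, self_mem_nhdsWithin] with w hw hw0
  have hw1 : 0 < |w| ^ N := pow_pos (abs_pos.2 hw0) N
  rw [norm_div, norm_mul, Real.norm_eq_abs, Real.norm_eq_abs, norm_pow, Real.norm_eq_abs,
    div_le_iff₀ hw1, mul_assoc, mul_assoc, ← pow_add, Nat.sub_add_cancel hNM.le]
  exact mul_le_mul_of_nonneg_left (hK w (by simpa using hw)) (abs_nonneg _)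

/-- A pair of polynomials `C₁, C₂` for which `C₁ A + C₂ B` has no terms of degree `D - 1, …, N - 1`
but has one of degree `N` yields a form of order `N`. -/
theorem hasHermitePadeForm_of_coeff {D N M : ℕ} (C₁ C₂ : ℤ[X]) (hD : 2 ≤ D) (hDN : D ≤ N)
    (hNM : N < M) (hC₁ : C₁.natDegree ≤ D) (hC₂ : C₂.natDegree + 1 ≤ D)
    (hvan : ∀ n < N, D ≤ n + 1 →
      (C₁ * shiftedTrunc stern M + C₂ * shiftedTrunc twistedStern M).coeff n = 0)
    (hne : (C₁ * shiftedTrunc stern M + C₂ * shiftedTrunc twistedStern M).coeff N ≠ 0) :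
    HasHermitePadeForm D N := by
  set E := C₁ * shiftedTrunc stern M + C₂ * shiftedTrunc twistedStern M with hE
  -- C₀ cancels exactly the degrees up to D − 2 that it may occupy; vanishing from D − 1 on has to
  -- come from C₁ and C₂.
  set C₀ : ℤ[X] := -∑ n ∈ Finset.range (D - 1), monomial n (E.coeff n) with hC₀
  have hcoeff : ∀ n, (C₀ + E).coeff n = if n < D - 1 then 0 else E.coeff n := by
    intro n
    rw [hC₀, coeff_add, coeff_neg, finsetSum_coeff]
    simp only [coeff_monomial, Finset.sum_ite_eq', Finset.mem_range]
    split_ifs <;> simp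
  obtain ⟨Q, hQ⟩ := X_pow_dvd_iff.2 (fun n (hn : n < N) => by
    rw [hcoeff]
    split_ifs with h
    · rfl
    · exact hvan n hn (by omega) : ∀ n < N, (C₀ + E).coeff n = 0)
  have hQ0 : Q.coeff 0 = E.coeff N := by
    have := hcoeff N
    rw [hQ, if_neg (by omega)] at this
    simpa using (coeff_X_pow_mul Q N 0).symm.trans ((congrArg _ (zero_add N)).trans this)
  refine ⟨C₀, C₁, C₂, ?_, hC₁, hC₂, (E.coeff N : ℝ), by exact_mod_cast hne, ?_⟩
  · have : C₀.natDegree ≤ D - 2 := by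
      rw [hC₀, natDegree_neg]
      refine natDegree_sum_le_of_forall_le _ _ fun n hn => (natDegree_monomial_le _).trans ?_
      have := Finset.mem_range.1 hn
      omega
    omega
  · have h1 : Tendsto (fun w : ℝ => aeval w Q) (𝓝[≠] 0) (𝓝 (E.coeff N : ℝ)) := by
      have := (Q.continuous_aeval (A := ℝ)).tendsto 0
      rw [← coeff_zero_eq_aeval_zero', hQ0] at this
      exact this.mono_left nhdsWithin_le_nhds
    have h2 := (h1.add (isSternLike_stern.tendsto_tail C₁ hNM)).add
      (isSternLike_twistedStern.tendsto_tail C₂ hNM)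
    rw [add_zero, add_zero] at h2
    refine h2.congr' ?_
    filter_upwards [self_mem_nhdsWithin] with w hw
    have hw0 : w ^ N ≠ 0 := pow_ne_zero N hw
    have h3 := congrArg (aeval w) hQ
    rw [hE] at h3
    simp only [map_add, map_mul, map_pow, aeval_X] at h3
    field_simp
    linear_combination -h3

/-- `C₁ A + C₂ B` in degree `n`, computed from lists of coefficients of `A`, `B` and
`C₁`, `C₂`. -/
def formCoeff (s t c₁ c₂ : List ℤ) (n : ℕ) : ℤ :=
  listDot c₁ (s.take (n + 1)).reverse + listDot c₂ (t.take (n + 1)).reverse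

theorem hasHermitePadeForm_of_lists {D N L : ℕ} {s t : List ℤ}
    (hs : s = (List.range L).map fun i => sternFuel 1 L (i + 1))
    (ht : t = (List.range L).map fun i => sternFuel (-1) L (i + 1)) (c₁ c₂ : List ℤ)
    (hNL : N < L)
    (h : (2 ≤ D ∧ D ≤ N ∧ c₁.length ≤ D + 1 ∧ c₂.length ≤ D) ∧
      (∀ n < N, D ≤ n + 1 → formCoeff s t c₁ c₂ n = 0) ∧ formCoeff s t c₁ c₂ N ≠ 0) :
    HasHermitePadeForm D N := by
  obtain ⟨⟨hD, hDN, hl₁, hl₂⟩, hvan, hne⟩ := h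
  have hco : ∀ n < L, (listPoly c₁ * shiftedTrunc stern L +
      listPoly c₂ * shiftedTrunc twistedStern L).coeff n = formCoeff s t c₁ c₂ n := by
    intro n hn
    rw [coeff_add, coeff_listPoly_mul, coeff_listPoly_mul, formCoeff,
      isSternLike_stern.reverse_take_eq hs hn, isSternLike_twistedStern.reverse_take_eq ht hn]
  refine hasHermitePadeForm_of_coeff (listPoly c₁) (listPoly c₂) hD hDN hNL
    (natDegree_listPoly_add_one_le hl₁) ?_ (fun n hn hn' => ?_) ?_
  · have := natDegree_listPoly_add_one_le (c := c₂) (d := D - 1) (by omega)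
    omega
  · rw [hco n (by omega), hvan n hn hn']
  · rwa [hco N hNL]

/-! ### Explicit forms -/

/-- The coefficients of `A`, up to degree 101. -/
def sternValues : List ℤ :=
  [1, 1, 2, 1, 3, 2, 3, 1, 4, 3, 5, 2, 5, 3, 4, 1, 5, 4, 7, 3, 8, 5, 7, 2, 7, 5, 8, 3, 7, 4, 5, 1,
  6, 5, 9, 4, 11, 7, 10, 3, 11, 8, 13, 5, 12, 7, 9, 2, 9, 7, 12, 5, 13, 8, 11, 3, 10, 7, 11, 4, 9,
  5, 6, 1, 7, 6, 11, 5, 14, 9, 13, 4, 15, 11, 18, 7, 17, 10, 13, 3, 14, 11, 19, 8, 21, 13, 18, 5,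
  17, 12, 19, 7, 16, 9, 11, 2, 11, 9, 16, 7, 19, 12]

/-- The coefficients of `B`, up to degree 101. -/
def twistedSternValues : List ℤ :=
  [1, -1, 0, 1, 1, 0, -1, -1, -2, -1, -1, 0, 1, 1, 2, 1, 3, 2, 3, 1, 2, 1, 1, 0, -1, -1, -2, -1,
  -3, -2, -3, -1, -4, -3, -5, -2, -5, -3, -4, -1, -3, -2, -3, -1, -2, -1, -1, 0, 1, 1, 2, 1, 3, 2,
  3, 1, 4, 3, 5, 2, 5, 3, 4, 1, 5, 4, 7, 3, 8, 5, 7, 2, 7, 5, 8, 3, 7, 4, 5, 1, 4, 3, 5, 2, 5, 3,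
  4, 1, 3, 2, 3, 1, 2, 1, 1, 0, -1, -1, -2, -1, -3, -2]

theorem sternValues_eq :
    sternValues = (List.range 102).map fun i => sternFuel 1 102 (i + 1) := by
  decide +kernel

theorem twistedSternValues_eq :
    twistedSternValues = (List.range 102).map fun i => sternFuel (-1) 102 (i + 1) := by
  decide +kernel

/-- The three polynomials have 3D coefficients in all, so linear algebra always gives a nonzero form
of order at least 3D − 1. Here that order is exact. -/
theorem hasHermitePadeForm_18_53 : HasHermitePadeForm 18 53 :=
  hasHermitePadeForm_of_lists sternValues_eq twistedSternValues_eq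
    [-1513, -576, -184, -102, 1776, 273, -327, 267, 60, -327, 267, 60, -1910, -168, 907, -303,
    2515, 1317, -962]
    [1653, 294, -1878, -150, 306, 351, 2121, 195, -1122, -87, -1041, -312, 826, -78, -725, 225,
    1509, 213]
    (by norm_num) (by decide +kernel)

theorem hasHermitePadeForm_19_56 : HasHermitePadeForm 19 56 :=
  hasHermitePadeForm_of_lists sternValues_eq twistedSternValues_eq
    [1, 0, -2, 0, -3, 0, 3, 0, 0, 0, 0, 0, 2, 0, -4, 0, -1, 0, 5]
    [-3, 0, 6, 0, -3, 0, -3, 0, 6, 0, 0, 0, -4, 0, 2, 0, -3, 0, 3]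
    (by norm_num) (by decide +kernel)

theorem hasHermitePadeForm_20_59 : HasHermitePadeForm 20 59 :=
  hasHermitePadeForm_of_lists sternValues_eq twistedSternValues_eq
    [-684, -7, 202, -434, 620, -399, -184, 609, 70, -14, -56, 70, -224, 154, 124, -756, 832, 189,
    -134, 875, -688]
    [-264, -427, 94, 1050, 212, -623, -348, -385, -74, 1176, 308, -154, -472, -756, -20, 350, 332,
    -469, -170, 665]
    (by norm_num) (by decide +kernel)

theorem hasHermitePadeForm_21_62 : HasHermitePadeForm 21 62 :=
  hasHermitePadeForm_of_lists sternValues_eq twistedSternValues_eq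
    [-55855, -42484, 11060, 17745, 51037, 25116, -24191, -14248, 19869, 8489, -8359, -130, -15301,
    -14794, 14580, 7878, 50341, 46566, 1206, -14755, -49349, -23348]
    [-8275, -29614, -18360, 18967, 45347, 16692, -31745, -36946, -31347, 9061, 52725, 26884,
    -32371, -40066, -24546, -1066, 44721, 13572, -32680, -5889, 19999]
    (by norm_num) (by decide +kernel)

theorem hasHermitePadeForm_22_65 : HasHermitePadeForm 22 65 :=
  hasHermitePadeForm_of_lists sternValues_eq twistedSternValues_eq
    [12312, -92, -18533, -1115, -5333, 1748, 19476, -544, -6873, 837, 1813, -770, 2292, 358,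
    -7352, 414, -9832, -922, 20637, 1905, 6479, -1804, -16996]
    [5642, 2818, -5369, -4029, -6667, 2236, 13182, 1502, -4035, -4047, -12685, 1692, 15286, 1822,
    -6224, -2178, -6958, 2556, 12021, -2357, -6103, 1880]
    (by norm_num) (by decide +kernel)

theorem hasHermitePadeForm_23_68 : HasHermitePadeForm 23 68 :=
  hasHermitePadeForm_of_lists sternValues_eq twistedSternValues_eq
    [-13052, 19270, 2812, -15047, 11589, -17835, -6908, 25748, 3616, -9799, 1617, 3157, -4706,
    2460, 6642, -9102, 10946, -14186, -5722, 14883, -8447, 19065, 2604, -20664]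
    [4396, 0, -4158, 11193, 1451, -21689, 6948, 11726, -13802, 15047, 2845, -26937, 6236, 11562,
    -4134, 6642, 5978, -18368, -5228, 22591, 459, -13817, 8792]
    (by norm_num) (by decide +kernel)

theorem hasHermitePadeForm_24_71 : HasHermitePadeForm 24 71 :=
  hasHermitePadeForm_of_lists sternValues_eq twistedSternValues_eq
    [6184, -8052, 4742, 4884, -12673, 7359, -1125, -8756, 10960, 3520, -3681, -605, 1835, -1606,
    -1452, 3894, -9322, 6182, -2394, -5390, 13605, -7117, 3143, 6468, -11704]
    [1392, 836, 3092, -4026, -721, 6545, -6943, -2068, 9334, -6974, -391, 8327, -9751, -2156,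
    7174, -2706, -898, 6446, -2252, -7524, 7385, 4081, -6519, 1672]
    (by norm_num) (by decide +kernel)

theorem hasHermitePadeForm_25_74 : HasHermitePadeForm 25 74 :=
  hasHermitePadeForm_of_lists sternValues_eq twistedSternValues_eq
    [-99508, 85184, -19868, -68288, 133582, -63536, -35118, 107976, -26989, -67408, 26670, 14256,
    -27389, 16984, 32490, -44880, 112861, -55616, -5556, 70224, -131844, 57024, 10222, -83864,
    45898, 26752]
    [19758, -15840, -38912, 42592, 39820, -76736, 36850, 37048, -103795, 67760, 28450, -98912,
    49675, 44440, -46882, 18656, 58123, -77792, -32152, 95216, -16166, -64592, 60198, -8712,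
    21684]
    (by norm_num) (by decide +kernel)

theorem hasHermitePadeForm_26_77 : HasHermitePadeForm 26 77 :=
  hasHermitePadeForm_of_lists sternValues_eq twistedSternValues_eq
    [57848, 24076, 35040, -133276, 4078, 49946, -95466, 134628, 20443, -139997, 46117, 53586,
    -64825, -3835, 42791, -35490, -92305, 39065, -56491, 107328, 63244, -58500, 64652, -124072,
    -14162, 95810, -31506]
    [41458, -3042, -52882, 24440, -11404, -78676, 34172, 102128, -100151, -9035, 111271, -127582,
    24831, 128765, -118409, -23426, 89933, -59449, -32569, 117364, -43662, -123058, 72562, 54756,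
    -116388, 24804]
    (by norm_num) (by decide +kernel)

theorem hasHermitePadeForm_27_80 : HasHermitePadeForm 27 80 :=
  hasHermitePadeForm_of_lists sternValues_eq twistedSternValues_eq
    [-262900, 125636, -218456, 53116, -203346, 102018, 261242, -258328, 448651, -26117, -280753,
    206192, 108479, -195559, 71953, 113680, 185975, -187915, 398719, -144158, 111964, 78988,
    -389764, 180320, -370278, 38514, 222398, -138964]
    [136246, 111622, -34774, -130732, 169828, -36260, -55772, 143080, -30567, -330603, 11933,
    283220, -377929, 137249, 242841, -378672, 268413, 258867, -178043, -45374, 242866, -184730,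
    -131610, 268128, 286296, -312228, 295212]
    (by norm_num) (by decide +kernel)

theorem hasHermitePadeForm_28_83 : HasHermitePadeForm 28 83 :=
  hasHermitePadeForm_of_lists sternValues_eq twistedSternValues_eq
    [-175737, -161320, 7148, -416324, 26926, -98124, -350760, -574462, -184102, 1311724, 403660,
    224183, -1140139, -724534, -37840, 859177, 636706, -431050, 238814, 499981, -796646, 798016,
    746128, -271876, 104633, -989232, -1114332, -43438, 2356388]
    [-2755737, 1056424, 1259212, -832426, 453416, 351352, -1455848, 606652, 3200074, -1918968,
    -290712, 1597697, -2020855, -470566, 1753328, -1296591, -1251540, 2295702, -856362, -827357,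
    931852, -228956, -349808, 1048950, -945363, -789876, 955824, 957708]
    (by norm_num) (by decide +kernel)

theorem hasHermitePadeForm_29_86 : HasHermitePadeForm 29 86 :=
  hasHermitePadeForm_of_lists sternValues_eq twistedSternValues_eq
    [3739054, -529465, -3105406, 368560, -3401480, 349690, 3612332, -576980, -1875102, 63036,
    -1692792, 633760, 3403640, -652358, -339294, -140862, -3809108, 853825, 3940526, -565692,
    3541010, -524263, -4552200, 961248, 1424154, -228531, 2586062, -835176, -3478566, 985422]
    [-1076710, -491793, -330078, 589696, -30588, -94758, 2075168, -520064, 2865874, 507586,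
    -2925732, -151640, 1067720, -214268, -384398, 338130, -3921816, -90253, 3209802, -57052,
    188074, -12291, -1542036, 65620, 81970, 27863, 946234, -96832, 1784066]
    (by norm_num) (by decide +kernel)

theorem hasHermitePadeForm_30_89 : HasHermitePadeForm 30 89 :=
  hasHermitePadeForm_of_lists sternValues_eq twistedSternValues_eq
    [-258486, 231911, -26855, -162254, 340856, -154690, -128626, 251968, -175402, -29946, 284808,
    -273048, -39160, 283774, -296674, 59520, 316614, -370357, 68813, 247690, -490170, 229369,
    221071, -417384, 278862, 99789, -440301, 360406, 85026, -425940, 373794]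
    [-152970, 207979, 50481, -252030, 192980, 40362, -268962, 225184, -69958, -211792, 166670,
    59892, -154624, 93124, 66980, -144832, 158010, 32085, -101045, 29574, -19298, 5549, 34299,
    -30504, 40394, -11749, -27275, 42842, -87854, 2914]
    (by norm_num) (by decide +kernel)

theorem hasHermitePadeForm_31_92 : HasHermitePadeForm 31 92 :=
  hasHermitePadeForm_of_lists sternValues_eq twistedSternValues_eq
    [-449, -2142, 3769, -1627, -2967, 3790, -3644, -146, 3139, -2993, 443, 2550, -3892, 1342,
    2860, -4202, 1931, 2271, -5101, 2830, 3530, -5556, 5095, 461, -5583, 4854, -573, -4281, 6028,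
    -1479, -4239, 5718]
    [-2355, -1308, 2175, -867, -2025, 3160, -670, -2490, 5469, -1907, -803, 2710, -1558, -1688,
    1696, -8, -2703, 2175, -1115, -1060, 1644, -316, 67, 249, -1025, 508, -351, -157, 1922, -961,
    961]
    (by norm_num) (by decide +kernel)

/-- This one has a structural source: (1 − 2y)A(y) − B(y) = −4y³ + ⋯, and five iterations of the
functional equations with y = w³² turn it into a form of order 3·32, with C₀ = −R₅ of degree 30. -/
theorem hasHermitePadeForm_32_96 : HasHermitePadeForm 32 96 :=
  hasHermitePadeForm_of_lists sternValues_eq twistedSternValues_eq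
    [1, 0, 0, 0, 0, 0, 0, 0, 0, 0, 0, 0, 0, 0, 0, 0, 0, 0, 0, 0, 0, 0, 0, 0, 0, 0, 0, 0, 0, 0, 0,
    0, -2]
    [1]
    (by norm_num) (by decide +kernel)

theorem hasHermitePadeForm_34_101 : HasHermitePadeForm 34 101 :=
  hasHermitePadeForm_of_lists sternValues_eq twistedSternValues_eq
    [-13489629, 1766975, 6918333, 1018395, -5166243, 3510150, 3272442, -3904005, 10320177,
    -1943340, -7203498, 4028640, 5057013, -1408995, 2019960, -3490830, -6079263, 4773300, 3188118,
    -284760, 2764620, -5359725, -4955028, 5517960, -9594627, 2695840, 8094489, -6738795, -3484452,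
    2652020, -2798550, 4732035, 29698413, -10451595, -14819268]
    [-8338071, 1945755, 2252085, -38745, 5858925, 2279480, 4149810, -3765825, -5945859, 1183910,
    -308178, 4029900, -8455185, -2819425, 1532640, 755370, 753993, 1153250, 1480296, -2847390,
    8992338, 355355, -6225960, 858690, 2912787, -37940, 1021941, -771435, -3161490, -226170,
    3653466, 1370775, -9044877, 321405]
    (by norm_num) (by decide +kernel)

/-! ### The chain and the final estimate -/

/-- The degree bounds of a chain of Hermite–Padé forms, closing up under doubling. -/
def chainDegree (j : ℕ) : ℕ := if j ≤ 14 then 18 + j else 2 * j + 4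

/-- The orders of vanishing of the forms of degree `chainDegree j`. -/
def chainOrder (j : ℕ) : ℕ := if j ≤ 13 then 53 + 3 * j else 5 * j + 26

theorem hasHermitePadeForm_chain {j : ℕ} (hj : j < 16) :
    HasHermitePadeForm (chainDegree j) (chainOrder j) := by
  interval_cases j
  exacts [hasHermitePadeForm_18_53, hasHermitePadeForm_19_56, hasHermitePadeForm_20_59,
    hasHermitePadeForm_21_62, hasHermitePadeForm_22_65, hasHermitePadeForm_23_68,
    hasHermitePadeForm_24_71, hasHermitePadeForm_25_74, hasHermitePadeForm_26_77,
    hasHermitePadeForm_27_80, hasHermitePadeForm_28_83, hasHermitePadeForm_29_86,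
    hasHermitePadeForm_30_89, hasHermitePadeForm_31_92, hasHermitePadeForm_32_96,
    hasHermitePadeForm_34_101]

theorem simApproxExponent_stern_le {a : ℤ} {b : ℕ} {l : ℝ} (ha : a ≠ 0) (hb : 2 ≤ b)
    (hl : Real.log |(a : ℝ)| = l * Real.log (b : ℝ)) (hl0 : 0 ≤ l) (hl1 : l < 50 / 77) :
    simApproxExponent ![sternA ((a : ℝ) / (b : ℝ)), sternB ((a : ℝ) / (b : ℝ))] ≤
      ((80 * (1 - l) / (50 - 77 * l) : ℝ) : EReal) := by
  have hb1 : (1 : ℝ) < b := by exact_mod_cast (by omega : 1 < b)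
  have hb0 : (0 : ℝ) < b := by linarith
  have hz : |(a : ℝ) / b| = (b : ℝ) ^ (-(1 - l)) := by
    have ha' : 0 < |(a : ℝ)| := abs_pos.2 (by exact_mod_cast ha)
    rw [abs_div, Nat.abs_cast, neg_sub, Real.rpow_sub_one hb0.ne', Real.rpow_def_of_pos hb0,
      mul_comm, ← hl, Real.exp_log ha']
  have hden : 0 < 50 - 77 * l := by linarith
  have hν : 1 ≤ 80 * (1 - l) / (50 - 77 * l) := by
    rw [le_div_iff₀ hden]
    linarith
  have hforms : ∀ j < 16, ∀ᶠ K : ℝ in atTop, HasIntegerForms (sternA ((a : ℝ) / b))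
      (sternB ((a : ℝ) / b)) b (1 - l) (chainDegree j) (chainOrder j) K := fun j hj =>
    (hasHermitePadeForm_chain hj).eventually_hasIntegerForms hb (by linarith) hz
  -- In order: N_j/(N_j − D_j) ≤ 77/50, N_{j+1}/(N_j − D_j) ≤ 8/5 and D_{j+1}/(N_j − D_j) ≤ 14/25.
  -- The second is an equality at j = 0, where it reads 56/35. For consecutive degrees and N = 3D −
  -- 1 it says (3D+2)/(2D−1) ≤ 8/5, that is D ≥ 18, which is why the chain starts there.
  have hsteps : ∀ j < 16, 77 * chainDegree j ≤ 27 * chainOrder j ∧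
      5 * chainOrder (j + 1) + 8 * chainDegree j ≤ 8 * chainOrder j ∧
      25 * chainDegree (j + 1) + 14 * chainDegree j ≤ 14 * chainOrder j := by
    decide
  -- Reduction to λ = 0: the first ratio bound gives N(1−λ) − D ≥ (N − D)(1 − 77λ/50).
  have hlin : ∀ j < 16, ((chainOrder j : ℝ) - chainDegree j) * (50 - 77 * l) ≤
      50 * (chainOrder j * (1 - l) - chainDegree j) := by
    intro j hj
    have h1 : (77 : ℝ) * chainDegree j ≤ 27 * chainOrder j := by exact_mod_cast (hsteps j hj).1
    nlinarith
  refine simApproxExponent_le (by linarith) fun μ hμ =>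
    exists_forall_not_approx (θ := 1 - l) hb1 16 chainDegree chainOrder rfl rfl (fun j hj => ?_) ?_ hν hμ
      (fun j hj => ?_) (fun j hj => ?_)
  · rcases hj.lt_or_eq with h | rfl
    · exact hforms j h
    -- Index 16 is the pair (36, 106), the double of (18, 53).
    · exact (hforms 0 (by norm_num)).mono fun K hK => hK.double
  · have := hlin 0 (by norm_num)
    norm_num [chainDegree, chainOrder] at this ⊢
    linarith
  · have h1 := hlin j hj
    have h2 : (25 : ℝ) * chainDegree (j + 1) + 14 * chainDegree j ≤ 14 * chainOrder j := by
      exact_mod_cast (hsteps j hj).2.2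
    -- Here 28 = 50·14/25; it is at most the required 30 − 3λ because λ < 50/77 < 2/3.
    have h3 : (chainDegree (j + 1) : ℝ) * (50 - 77 * l) ≤
        28 * (chainOrder j * (1 - l) - chainDegree j) := by nlinarith
    have h4 : 0 ≤ (chainOrder j : ℝ) * (1 - l) - chainDegree j := by
      have : 0 ≤ (chainDegree (j + 1) : ℝ) * (50 - 77 * l) := by positivity
      linarith
    have h5 : 80 * (1 - l) / (50 - 77 * l) - 1 = (30 - 3 * l) / (50 - 77 * l) := by
      rw [div_sub_one hden.ne']
      congr 1
      ring
    rw [h5, div_mul_eq_mul_div, le_div_iff₀ hden]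
    nlinarith
  · have h1 := hlin j hj
    have h2 : (5 : ℝ) * chainOrder (j + 1) + 8 * chainDegree j ≤ 8 * chainOrder j := by
      exact_mod_cast (hsteps j hj).2.1
    have h3 : (chainOrder (j + 1) : ℝ) * (50 - 77 * l) ≤
        80 * (chainOrder j * (1 - l) - chainDegree j) := by nlinarith
    rw [div_mul_eq_mul_div, le_div_iff₀ hden]
    have h4 : 0 ≤ 1 - l := by linarith
    nlinarith [mul_le_mul_of_nonneg_left h3 h4]

theorem theorem1 :
    (∀ b : ℕ, 2 ≤ b →
      simApproxExponent ![sternA (1 / (b : ℝ)), sternB (1 / (b : ℝ))] ≤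
        ((8 / 5 : ℝ) : EReal)) ∧
    (∀ (a : ℤ) (b : ℕ) (l : ℝ), a ≠ 0 → 2 ≤ b →
      Real.log |(a : ℝ)| = l * Real.log (b : ℝ) → 0 ≤ l → l < 50 / 77 →
      simApproxExponent ![sternA ((a : ℝ) / (b : ℝ)), sternB ((a : ℝ) / (b : ℝ))] ≤
        ((80 * (1 - l) / (50 - 77 * l) : ℝ) : EReal)) := by
  refine ⟨fun b hb => ?_, fun a b l ha hb hl hl0 hl1 => simApproxExponent_stern_le ha hb hl hl0 hl1⟩
  have h := simApproxExponent_stern_le (a := 1) (l := 0) one_ne_zero hb (by simp) le_rfl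
    (by norm_num)
  norm_num at h ⊢
  exact h
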